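/- Let $R$ be a commutative Bezout domain (an integral domain in which every finitely generated ideal is principal) of stable range $1.5$, that is: for all $a,b\in R$ and $0\ne c\in R$ with $aR+bR+cR=R$ there exists $r\in R$ with $(a+br)R+cR=R$. Say that an $n\times m$ matrix $\Phi$ over $R$ is in Smith normal form if $\Phi=\operatorname{diag}(\varphi_1,\dots,\varphi_k,0,\dots,0)$ with all $\varphi_i\neq 0$ and $\varphi_i\mid\varphi_{i+1}$ for $1\le i<k$. For $A\in R^{n\times m}$ let $\mathrm{T}_l(A)$ be the set of all $P\in GL_n(R)$ such that $PAQ$ is in Smith normal form for some $Q\in GL_m(R)$, and let $\mathrm{T}_r(A)$ be the set of all $Q\in GL_m(R)$ such that $PAQ$ is in Smith normal form for some $P\in GL_n(R)$. An elementary matrix is a matrix obtained from the identity matrix by adding a multiple of one row to another row, by interchanging two rows, or by multiplying a row by a unit of $R$. If $\operatorname{rank}(A)>1$, then $\mathrm{T}_l(A)$ contains a product of elementary matrices, and $\mathrm{T}_r(A)$ contains a product of elementary matrices. -/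

import Mathlib

namespace StableRange

/-- A commutative ring has stable range 1.5: whenever `aR + bR + cR = R` and `c ≠ 0`, there is
`r` with `(a + br)R + cR = R`. -/
def HasStableRangeOneAndHalf (R : Type*) [CommRing R] : Prop :=
  ∀ a b c : R, c ≠ 0 → Ideal.span {a, b, c} = ⊤ → ∃ r : R, Ideal.span {a + b * r, c} = ⊤

/-- `Φ = diag(φ₁, …, φ_k, 0, …, 0)` (not necessarily square) with all `φᵢ` nonzero and
`φᵢ ∣ φᵢ₊₁`. -/
def IsSmithNormalForm {R : Type*} [CommRing R] {n m : ℕ} (Φ : Matrix (Fin n) (Fin m) R) : Prop :=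
  ∃ k : ℕ, k ≤ n ∧ k ≤ m ∧ ∃ φ : Fin k → R,
    (∀ i, φ i ≠ 0) ∧
    (∀ (i : ℕ) (h : i + 1 < k), φ ⟨i, Nat.lt_of_succ_lt h⟩ ∣ φ ⟨i + 1, h⟩) ∧
    Φ = Matrix.of fun (i : Fin n) (j : Fin m) =>
      if h : (i : ℕ) = (j : ℕ) ∧ (i : ℕ) < k then φ ⟨i, h.2⟩ else 0

/-- The matrices obtained from the identity matrix by one elementary transformation: adding a
multiple of one row to a different row, interchanging two rows, multiplying a row by a unit. -/
inductive IsElementary {R : Type*} [CommRing R] {n : ℕ} : Matrix (Fin n) (Fin n) R → Prop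
  | add (i j : Fin n) (hij : i ≠ j) (c : R) : IsElementary (Matrix.transvection i j c)
  | interchange (i j : Fin n) : IsElementary ((Equiv.swap i j).permMatrix R)
  | scale (i : Fin n) (u : Rˣ) :
      IsElementary (Matrix.diagonal (Function.update (fun _ => (1 : R)) i (u : R)))

/-- `M` is a (finite) product of elementary matrices, i.e. it is obtained from the identity matrix
by finitely many elementary transformations. -/
def IsProductOfElementary {R : Type*} [CommRing R] {n : ℕ} (M : Matrix (Fin n) (Fin n) R) : Prop :=
  ∃ L : List (Matrix (Fin n) (Fin n) R), (∀ E ∈ L, IsElementary E) ∧ L.prod = M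

/-- The left transforming matrices of `A`: the invertible `P` such that `P * A * Q` is in Smith
normal form for some invertible `Q`. -/
def leftTransforming {R : Type*} [CommRing R] {n m : ℕ} (A : Matrix (Fin n) (Fin m) R) :
    Set (Matrix (Fin n) (Fin n) R) :=
  {P | IsUnit P ∧ ∃ Q : Matrix (Fin m) (Fin m) R, IsUnit Q ∧ IsSmithNormalForm (P * A * Q)}

/-- The right transforming matrices of `A`: the invertible `Q` such that `P * A * Q` is in Smith
normal form for some invertible `P`. -/
def rightTransforming {R : Type*} [CommRing R] {n m : ℕ} (A : Matrix (Fin n) (Fin m) R) :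
    Set (Matrix (Fin m) (Fin m) R) :=
  {Q | IsUnit Q ∧ ∃ P : Matrix (Fin n) (Fin n) R, IsUnit P ∧ IsSmithNormalForm (P * A * Q)}

end StableRange

namespace StableRange

open Matrix

/-! Some Smith form `P * A * Q = Φ` exists: stable range 1.5 yields `x`, `u` for which `x A u` is a
gcd of the entries of `A`. Once this gcd is divided out, `x` and `u` are unimodular and complete to
invertible matrices, which bring the gcd to the corner; clearing its row and column leaves a smaller
matrix (`exists_content`, `exists_isSmithNormalForm`).

The matrix `P` need not be a product of elementary matrices, but it may be replaced by `X⁻¹ * P`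
whenever `X * Φ = Φ * K` with `X`, `K` invertible. Since the rank exceeds 1, `Φ` begins with a block
`diag(a, δ a)`, `δ ≠ 0`. Column operations turn `P` into `H ⊕ 1` with `H` of size 2 and `δ ∣ H 1 0`
(`exists_mul_eq_fromBlocks`). This divisibility is exactly what lets `H` pass through `diag(a, δ
a)`, so `X = H ⊕ 1` is admissible and `X⁻¹ * P` is a product of transvections. The right-hand
statement follows by transposition. -/

theorem transvection_apply {ι R : Type*} [DecidableEq ι] [CommRing R] (i j k l : ι) (c : R) :
    transvection i j c k l = (1 : Matrix ι ι R) k l + if i = k ∧ j = l then c else 0 := by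
  simp [transvection, single_apply]

/-! ### Transvections acting on rows by column operations -/

section Transvections

variable {ι R : Type*} [Fintype ι] [DecidableEq ι] [CommRing R]

/-- The monoid generated by the transvections that leave the rows with index in `s` unchanged. -/
def transvections (R : Type*) [CommRing R] (s : Set ι) : Submonoid (Matrix ι ι R) :=
  Submonoid.closure {M | ∃ i j, i ≠ j ∧ i ∉ s ∧ ∃ c : R, M = transvection i j c}

theorem transvection_mem {s : Set ι} {i j : ι} (hij : i ≠ j) (hi : i ∉ s) (c : R) :
    transvection i j c ∈ transvections R s :=
  Submonoid.subset_closure ⟨i, j, hij, hi, c, rfl⟩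

theorem transvections_mono {s t : Set ι} (h : s ⊆ t) : transvections R t ≤ transvections R s :=
  Submonoid.closure_mono fun _ ⟨i, j, hij, hi, c, hM⟩ => ⟨i, j, hij, fun his => hi (h his), c, hM⟩

theorem row_of_mem_transvections {s : Set ι} {e : Matrix ι ι R} (he : e ∈ transvections R s)
    {i : ι} (hi : i ∈ s) : e i = (1 : Matrix ι ι R) i := by
  induction he using Submonoid.closure_induction with
  | mem x hx =>
    obtain ⟨a, b, -, ha, c, rfl⟩ := hx
    have hai : a ≠ i := fun h => ha (h ▸ hi)
    ext l
    simp [transvection_apply, hai]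
  | one => rfl
  | mul x y _ _ hx hy =>
    have : (x * y) i = x i ᵥ* y := by
      ext l; simp [Matrix.mul_apply, vecMul, dotProduct]
    rw [this, hx]
    ext l
    simp [vecMul, dotProduct, Matrix.one_apply, hy]

theorem exists_inverse_mem_transvections {s : Set ι} {e : Matrix ι ι R}
    (he : e ∈ transvections R s) : ∃ f ∈ transvections R s, e * f = 1 := by
  induction he using Submonoid.closure_induction with
  | mem x hx =>
    obtain ⟨a, b, hab, ha, c, rfl⟩ := hx
    exact ⟨transvection a b (-c), transvection_mem hab ha _, by
      simp [transvection_mul_transvection_same _ _ hab]⟩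
  | one => exact ⟨1, one_mem _, one_mul 1⟩
  | mul x y _ _ hx hy =>
    obtain ⟨f, hf, hxf⟩ := hx
    obtain ⟨g, hg, hyg⟩ := hy
    exact ⟨g * f, mul_mem hg hf, by rw [mul_assoc, ← mul_assoc y, hyg, one_mul, hxf]⟩

theorem reindex_mem_transvections {κ : Type*} [Fintype κ] [DecidableEq κ] (σ : ι ≃ κ)
    {e : Matrix ι ι R} (he : e ∈ transvections R (∅ : Set ι)) :
    reindex σ σ e ∈ transvections R (∅ : Set κ) := by
  have h : transvections R (∅ : Set ι) ≤
      (transvections R (∅ : Set κ)).comap (reindexAlgEquiv R R σ : Matrix ι ι R →* _) := by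
    refine Submonoid.closure_le.2 ?_
    rintro _ ⟨i, j, hij, -, c, rfl⟩
    have : reindex σ σ (transvection i j c) = transvection (σ i) (σ j) c := by
      ext k l
      simp [transvection_apply, Matrix.one_apply, Equiv.eq_symm_apply]
    simp only [Submonoid.coe_comap, Set.mem_preimage, SetLike.mem_coe]
    change reindex σ σ (transvection i j c) ∈ _
    rw [this]
    exact transvection_mem (σ.injective.ne hij) (Set.notMem_empty _) c
  exact h he

theorem fromBlocks_mem_transvections {κ : Type*} [Fintype κ] [DecidableEq κ] (X : Matrix ι κ R) :
    fromBlocks 1 X 0 1 ∈ transvections R (∅ : Set (ι ⊕ κ)) := by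
  induction X using Matrix.induction_on' with
  | h_zero => rw [fromBlocks_one]; exact one_mem _
  | h_add X Y hX hY =>
    have h := mul_mem hX hY
    rwa [fromBlocks_multiply, Matrix.one_mul, Matrix.mul_one, Matrix.mul_zero, Matrix.zero_mul,
      Matrix.one_mul, Matrix.mul_one, Matrix.mul_zero, add_zero, Matrix.zero_mul, add_zero, zero_add,
      add_comm Y X] at h
  | h_std_basis i j c =>
    have : fromBlocks 1 (single i j c) 0 1 = transvection (Sum.inl i) (Sum.inr j) c := by
      ext (k | k) (l | l) <;> simp [transvection_apply, Matrix.one_apply, single_apply]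
    rw [this]
    exact transvection_mem Sum.inl_ne_inr (Set.notMem_empty _) c

/-- `w` is obtained from the row `v` by right multiplication with an element of
`transvections R s`. -/
def Reaches (s : Set ι) (v w : ι → R) : Prop := ∃ e ∈ transvections R s, v ᵥ* e = w

theorem Reaches.refl (s : Set ι) (v : ι → R) : Reaches s v v := ⟨1, one_mem _, vecMul_one v⟩

theorem Reaches.trans {s : Set ι} {u v w : ι → R} (h : Reaches s u v) (h' : Reaches s v w) :
    Reaches s u w := by
  obtain ⟨e, he, rfl⟩ := h
  obtain ⟨f, hf, rfl⟩ := h'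
  exact ⟨e * f, mul_mem he hf, by rw [vecMul_vecMul]⟩

theorem reaches_update {s : Set ι} (v : ι → R) {i j : ι} (hij : i ≠ j) (hi : i ∉ s) (c : R) :
    Reaches s v (Function.update v j (v j + v i * c)) := by
  refine ⟨_, transvection_mem hij hi c, ?_⟩
  ext l
  have h : (v ᵥ* single i j c) l = if j = l then v i * c else 0 := by
    simp [vecMul, dotProduct, single_apply, ite_and]
  rcases eq_or_ne l j with rfl | hl
  · simp [transvection, vecMul_add, h]
  · simp [transvection, vecMul_add, h, hl, hl.symm]

theorem reaches_update_sum {s : Set ι} (v : ι → R) (j : ι) (F : Finset ι)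
    (hF : ∀ i ∈ F, i ≠ j ∧ i ∉ s) (c : ι → R) :
    Reaches s v (Function.update v j (v j + ∑ i ∈ F, v i * c i)) := by
  classical
  induction F using Finset.induction_on with
  | empty => simpa using Reaches.refl s v
  | insert a F ha ih =>
    have haj := hF a (Finset.mem_insert_self a F)
    refine (ih fun i hi => hF i (Finset.mem_insert_of_mem hi)).trans ?_
    convert reaches_update _ haj.1 haj.2 (c a) using 1
    simp [haj.1, Finset.sum_insert ha]
    ring_nf

theorem reaches_single {s : Set ι} (v : ι → R) {t : ι} (ht : t ∉ s) (hv : v t = 1) :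
    Reaches s v (Pi.single t 1) := by
  have h : ∀ F : Finset ι, t ∉ F → Reaches s v fun j => if j ∈ F then 0 else v j := by
    intro F
    induction F using Finset.induction_on with
    | empty => intro; simpa using Reaches.refl s v
    | insert a F ha ih =>
      intro htF
      rw [Finset.mem_insert, not_or] at htF
      refine (ih htF.2).trans ?_
      convert reaches_update _ htF.1 ht (-v a) using 1
      ext j
      rcases eq_or_ne j a with rfl | hj
      · simp [ha, htF.2, hv]
      · simp [hj]
  convert h (Finset.univ.erase t) (by simp) using 1
  ext j
  rcases eq_or_ne j t with rfl | hj
  · simp [hv]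
  · simp [hj]

/-- A combination of the entries at `i` and `j` brings the entry at `t` to 1, which then clears all
the others. -/
theorem reaches_single_of_coprime {s : Set ι} (v : ι → R) {i j t : ι} (hit : i ≠ t)
    (hjt : j ≠ t) (hi : i ∉ s) (hj : j ∉ s) (ht : t ∉ s) (h : IsCoprime (v i) (v j)) :
    Reaches s v (Pi.single t 1) := by
  obtain ⟨x, y, hxy⟩ := h
  refine (reaches_update v hit hi (x * (1 - v t))).trans <|
    (reaches_update _ hjt hj (y * (1 - v t))).trans <| reaches_single _ ht ?_
  simp [hjt]
  linear_combination (1 - v t) * hxy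

end Transvections

theorem isCoprime_iff_span_pair {R : Type*} [CommRing R] {a b : R} :
    IsCoprime a b ↔ Ideal.span {a, b} = ⊤ := by
  rw [Ideal.eq_top_iff_one, Ideal.mem_span_pair]
  rfl

theorem exists_gcd_family {ι R : Type*} [CommRing R] [IsBezout R] (F : Finset ι) (v : ι → R) :
    ∃ (g : R) (c q : ι → R), g = ∑ i ∈ F, v i * c i ∧ ∀ i ∈ F, v i = g * q i := by
  classical
  obtain ⟨g, hg⟩ := (IsBezout.isPrincipal_of_FG (Ideal.span (v '' F))
    ⟨F.image v, by simp⟩).principal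
  have hmem : ∀ i ∈ F, g ∣ v i := fun i hi => by
    rw [← Ideal.mem_span_singleton]
    change v i ∈ Submodule.span R {g}
    exact hg ▸ Ideal.subset_span ⟨i, hi, rfl⟩
  have hgm : g ∈ Ideal.span (v '' F) := hg ▸ Ideal.mem_span_singleton_self g
  obtain ⟨c, hc⟩ := (Submodule.mem_span_image_finset_iff_exists_fun' R).1 hgm
  choose! q hq using hmem
  exact ⟨g, c, q, by simp [← hc, mul_comm], hq⟩

/-! ### Unimodular rows under stable range 1.5 -/

section Bezout

variable {ι R : Type*} [Fintype ι] [DecidableEq ι] [CommRing R]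

theorem HasStableRangeOneAndHalf.exists_isCoprime (hR : HasStableRangeOneAndHalf R) {a b c : R}
    (hc : c ≠ 0) (h : ∃ x y z, x * a + y * b + z * c = 1) : ∃ r, IsCoprime (a + b * r) c := by
  obtain ⟨x, y, z, h⟩ := h
  obtain ⟨r, hr⟩ := hR a b c hc <| by
    rw [Ideal.eq_top_iff_one, Ideal.mem_span_insert']
    refine ⟨-x, ?_⟩
    rw [Ideal.mem_span_pair]
    exact ⟨y, z, by linear_combination h⟩
  exact ⟨r, isCoprime_iff_span_pair.2 hr⟩

/-- Two positions other than `t` are made coprime, which is why three free positions are needed. A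
nonzero entry `v c` serves as the modulus of the stable range condition; if there is none, `v t` is
a unit and creates an entry 1 at `p`. -/
theorem HasStableRangeOneAndHalf.reaches_single [IsDomain R] [IsBezout R]
    (hR : HasStableRangeOneAndHalf R) {s : Set ι} {p q t : ι} (hpq : p ≠ q) (hpt : p ≠ t)
    (hqt : q ≠ t) (hp : p ∉ s) (hq : q ∉ s) (ht : t ∉ s) (v u : ι → R) (hu : ∀ i ∈ s, u i = 0)
    (hvu : v ⬝ᵥ u = 1) : Reaches s v (Pi.single t 1) := by
  classical
  by_cases hc : ∃ c, c ≠ t ∧ c ∉ s ∧ v c ≠ 0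
  · obtain ⟨c, hct, hcs, hvc⟩ := hc
    obtain ⟨i, hic, hit, his⟩ : ∃ i, i ≠ c ∧ i ≠ t ∧ i ∉ s := by
      rcases eq_or_ne p c with rfl | h
      · exact ⟨q, hpq.symm, hqt, hq⟩
      · exact ⟨p, h, hpt, hp⟩
    -- The gcd `g` of the remaining free entries, `v t` included, is what gets added to `v i`.
    let F : Finset ι := Finset.univ.filter fun j => j ≠ i ∧ j ≠ c ∧ j ∉ s
    obtain ⟨g, k, l, hg, hl⟩ := exists_gcd_family F v
    have hsum : v i * u i + (v c * u c + ∑ j ∈ F, v j * u j) = 1 := by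
      have hcF : c ∉ F := by simp [F]
      have hiF : i ∉ insert c F := by simp [F, hic]
      rw [← Finset.sum_insert (f := fun j => v j * u j) hcF,
        ← Finset.sum_insert (f := fun j => v j * u j) hiF, ← hvu, dotProduct]
      refine Finset.sum_subset (Finset.subset_univ _) fun j _ hj => ?_
      rw [hu j, mul_zero]
      simp only [F, Finset.mem_insert, Finset.mem_filter, Finset.mem_univ, true_and] at hj
      tauto
    have hgF : ∑ j ∈ F, v j * u j = g * ∑ j ∈ F, l j * u j := by
      rw [Finset.mul_sum]
      refine Finset.sum_congr rfl fun j hj => ?_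
      conv_lhs => rw [hl j hj]
      ring
    obtain ⟨r, hr⟩ := hR.exists_isCoprime (a := v i) (b := g) hvc
      ⟨u i, ∑ j ∈ F, l j * u j, u c, by rw [← hsum, hgF]; ring⟩
    refine (reaches_update_sum v i F (by simp [F]; tauto) fun j => k j * r).trans <|
      reaches_single_of_coprime _ hit hct his hcs ht ?_
    have : ∑ j ∈ F, v j * (k j * r) = g * r := by
      rw [hg, Finset.sum_mul]
      exact Finset.sum_congr rfl fun j _ => by ring
    simpa [this, hic.symm] using hr
  · push Not at hc
    have hvt : v t * u t = 1 := by
      rw [← hvu, dotProduct, Finset.sum_eq_single t]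
      · intro j _ hj
        by_cases hjs : j ∈ s
        · rw [hu j hjs, mul_zero]
        · rw [hc j hj hjs, zero_mul]
      · simp
    refine (reaches_update v hpt.symm ht (u t)).trans <|
      reaches_single_of_coprime _ hpt hqt hp hq ht ?_
    rw [Function.update_self, hc p hpt hp, zero_add, hvt]
    exact isCoprime_one_left

end Bezout

/-! ### Reduction of an invertible matrix to a 2 × 2 block -/

section RowReduction

variable {ι R : Type*} [Fintype ι] [DecidableEq ι] [CommRing R]

theorem mul_row_of_row_eq_one {g e : Matrix ι ι R} {i : ι} (h : g i = (1 : Matrix ι ι R) i) :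
    (g * e) i = e i := by
  rw [Matrix.mul_apply_eq_vecMul, h, ← Matrix.mul_apply_eq_vecMul, Matrix.one_mul]

theorem isUnit_of_mem_transvections {s : Set ι} {e : Matrix ι ι R}
    (he : e ∈ transvections R s) : IsUnit e := by
  obtain ⟨f, -, hf⟩ := exists_inverse_mem_transvections he
  exact IsUnit.of_mul_eq_one f hf

variable [IsDomain R] [IsBezout R]

/-- Right multiplication by transvections makes every row of an invertible matrix standard, except
for two prescribed ones. -/
theorem HasStableRangeOneAndHalf.exists_standard_rows (hR : HasStableRangeOneAndHalf R)
    {g : Matrix ι ι R} (hg : IsUnit g) {p q : ι} (hpq : p ≠ q) (s : Finset ι) (hp : p ∉ s)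
    (hq : q ∉ s) :
    ∃ e ∈ transvections R (∅ : Set ι), ∀ i ∈ s, (g * e) i = (1 : Matrix ι ι R) i := by
  induction s using Finset.induction_on with
  | empty => exact ⟨1, one_mem _, by simp⟩
  | insert t s hts ih =>
    rw [Finset.mem_insert, not_or] at hp hq
    obtain ⟨e, he, hes⟩ := ih hp.2 hq.2
    obtain ⟨k, hk⟩ := (hg.mul (isUnit_of_mem_transvections he)).exists_right_inv
    -- Column `t` of the inverse is the witness of unimodularity; it vanishes on `s` because the
    -- rows of `g * e` there are standard. Operations whose source column lies outside `s` preserve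
    -- those rows.
    obtain ⟨f, hf, hft⟩ := hR.reaches_single (s := (s : Set ι)) hpq hp.1 hq.1 (by simpa using hp.2)
      (by simpa using hq.2) (by simpa using hts) ((g * e) t) (fun j => k j t)
      (fun i hi => by
        have hit : i ≠ t := fun h => hts (h ▸ hi)
        rw [← mul_row_of_row_eq_one (e := k) (hes i hi), hk, one_apply_ne hit])
      (by rw [← one_apply_eq (α := R) t, ← hk]; rfl)
    refine ⟨e * f, mul_mem he (transvections_mono (Set.empty_subset _) hf), fun i hi => ?_⟩
    rw [← Matrix.mul_assoc]
    rcases Finset.mem_insert.1 hi with rfl | hi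
    · rw [Matrix.mul_apply_eq_vecMul, hft]
      ext j
      simp [Matrix.one_apply, Pi.single_apply, eq_comm]
    · rw [mul_row_of_row_eq_one (hes i hi), row_of_mem_transvections hf (by simpa using hi)]

/-- An invertible matrix is, up to right multiplication by transvections, an invertible `2 × 2`
block whose lower left entry is divisible by a given nonzero element. -/
theorem HasStableRangeOneAndHalf.exists_mul_eq_fromBlocks (hR : HasStableRangeOneAndHalf R)
    {κ : Type*} [Fintype κ] [DecidableEq κ] {g : Matrix (Fin 2 ⊕ κ) (Fin 2 ⊕ κ) R} (hg : IsUnit g)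
    {δ : R} (hδ : δ ≠ 0) :
    ∃ e ∈ transvections R (∅ : Set (Fin 2 ⊕ κ)), ∃ h : Matrix (Fin 2) (Fin 2) R,
      IsUnit h ∧ δ ∣ h 1 0 ∧ g * e = fromBlocks h 0 0 1 := by
  obtain ⟨e, he, hes⟩ := hR.exists_standard_rows hg (p := Sum.inl 0) (q := Sum.inl 1)
    (by simp) (Finset.univ.map Function.Embedding.inr) (by simp) (by simp)
  have hes : ∀ i, (g * e) (Sum.inr i) = (1 : Matrix (Fin 2 ⊕ κ) (Fin 2 ⊕ κ) R) (Sum.inr i) :=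
    fun i => hes _ (by simp)
  obtain ⟨k, hk⟩ := (hg.mul (isUnit_of_mem_transvections he)).exists_right_inv
  have hk1 : ∀ i, k (Sum.inr i) (Sum.inl 1) = 0 := fun i => by
    rw [← mul_row_of_row_eq_one (e := k) (hes i), hk, one_apply_ne (by simp)]
  set v := (g * e) (Sum.inl 1) with hv
  have hvk : v (Sum.inl 0) * k (Sum.inl 0) (Sum.inl 1) +
      v (Sum.inl 1) * k (Sum.inl 1) (Sum.inl 1) = 1 := by
    have := congr_fun₂ hk (Sum.inl 1) (Sum.inl 1)
    rw [Matrix.mul_apply] at this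
    simpa [hk1] using this
  -- With `w = v₁ + v₀ r` and `x w + y δ = 1`, subtracting `x v₀` times `w` from `v₀` leaves `v₀ y
  -- δ`.
  obtain ⟨r, x, y, hxy⟩ := hR.exists_isCoprime (a := v (Sum.inl 1)) (b := v (Sum.inl 0)) hδ
    ⟨k (Sum.inl 1) (Sum.inl 1), k (Sum.inl 0) (Sum.inl 1), 0, by rw [← hvk]; ring⟩
  let s : Set (Fin 2 ⊕ κ) := Set.range Sum.inr
  obtain ⟨f, hf, hvf⟩ := (reaches_update (s := s) v (i := Sum.inl 0) (j := Sum.inl 1)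
    (by simp) (by simp [s]) r).trans (reaches_update _ (i := Sum.inl 1) (j := Sum.inl 0)
    (by simp) (by simp [s]) (-(x * v (Sum.inl 0))))
  let H := g * (e * f)
  have hHs : ∀ i, H (Sum.inr i) = (1 : Matrix (Fin 2 ⊕ κ) (Fin 2 ⊕ κ) R) (Sum.inr i) := fun i => by
    rw [← row_of_mem_transvections hf (Set.mem_range_self i),
      ← mul_row_of_row_eq_one (e := f) (hes i), Matrix.mul_assoc]
  have hH : H = fromBlocks H.toBlocks₁₁ H.toBlocks₁₂ 0 1 := by
    conv_lhs => rw [← fromBlocks_toBlocks H]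
    congr 1
    · ext i j
      simp [toBlocks₂₁, hHs]
    · ext i j
      simp [toBlocks₂₂, hHs, Matrix.one_apply]
  have hef := mul_mem he (transvections_mono (Set.empty_subset _) hf)
  have hunit : IsUnit H.toBlocks₁₁ := by
    have h : IsUnit H := hg.mul (isUnit_of_mem_transvections hef)
    rw [isUnit_iff_isUnit_det, hH, det_fromBlocks_zero₂₁, det_one, mul_one] at h
    rwa [isUnit_iff_isUnit_det]
  obtain ⟨z, hz⟩ := hunit.exists_right_inv
  -- The last factor clears the upper right block, since `z` inverts the upper left one.
  refine ⟨e * f * fromBlocks 1 (-(z * H.toBlocks₁₂)) 0 1,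
    mul_mem hef (fromBlocks_mem_transvections _), H.toBlocks₁₁, hunit, ?_, ?_⟩
  · refine ⟨v (Sum.inl 0) * y, ?_⟩
    change (g * (e * f)) (Sum.inl 1) (Sum.inl 0) = _
    rw [← Matrix.mul_assoc, Matrix.mul_apply_eq_vecMul, ← hv, hvf]
    simp
    linear_combination (-v (Sum.inl 0)) * hxy
  · rw [← Matrix.mul_assoc]
    change H * _ = _
    conv_lhs => rw [hH]
    rw [fromBlocks_multiply]
    simp [← Matrix.mul_assoc, hz]

end RowReduction

/-! ### Representing the gcd of all entries as `x A u` -/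

section Content

variable {R : Type*} [CommRing R] [IsDomain R] [IsBezout R]

/-- Dividing by the gcd of `a`, `b`, `c` gives a unimodular triple whose last term is still nonzero.
-/
theorem HasStableRangeOneAndHalf.exists_gcd (hR : HasStableRangeOneAndHalf R) (a b : R) {c : R}
    (hc : c ≠ 0) :
    ∃ r x y, x * (a + b * r) + y * c ∣ a ∧ x * (a + b * r) + y * c ∣ b ∧
      x * (a + b * r) + y * c ∣ c := by
  obtain ⟨g, k, q, hg, hq⟩ := exists_gcd_family Finset.univ ![a, b, c]
  have ha : a = g * q 0 := hq 0 (Finset.mem_univ _)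
  have hb : b = g * q 1 := hq 1 (Finset.mem_univ _)
  have hc' : c = g * q 2 := hq 2 (Finset.mem_univ _)
  have hg0 : g ≠ 0 := fun h => hc (by rw [hc', h, zero_mul])
  have hq2 : q 2 ≠ 0 := fun h => hc (by rw [hc', h, mul_zero])
  obtain ⟨r, x, y, h⟩ := hR.exists_isCoprime (a := q 0) (b := q 1) hq2
    ⟨k 0, k 1, k 2, mul_left_cancel₀ hg0 (by
      simp [Fin.sum_univ_three] at hg
      linear_combination -hg - k 0 * ha - k 1 * hb - k 2 * hc')⟩
  have hgr : x * (a + b * r) + y * c = g := by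
    linear_combination x * ha + x * r * hb + y * hc' + g * h
  exact ⟨r, x, y, hgr ▸ ⟨_, ha⟩, hgr ▸ ⟨_, hb⟩, hgr ▸ ⟨_, hc'⟩⟩

variable {ι κ : Type*} [Fintype ι] [Fintype κ]

/-- Some combination of two rows has the same content as the two rows together. -/
theorem HasStableRangeOneAndHalf.exists_content_pair (hR : HasStableRangeOneAndHalf R)
    (α β : ι → R) :
    ∃ (x y : R) (u : ι → R), ∀ i, (x • α + y • β) ⬝ᵥ u ∣ α i ∧ (x • α + y • β) ⬝ᵥ u ∣ β i := by
  obtain ⟨a, k, l, ha, hl⟩ := exists_gcd_family Finset.univ α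
  replace hl : ∀ i, α i = a * l i := fun i => hl i (Finset.mem_univ i)
  change a = α ⬝ᵥ k at ha
  by_cases ha0 : a = 0
  · obtain ⟨b, k, q, hb, hq⟩ := exists_gcd_family Finset.univ β
    change b = β ⬝ᵥ k at hb
    refine ⟨0, 1, k, fun i => ⟨by simp [hl, ha0], ?_⟩⟩
    rw [zero_smul, one_smul, zero_add, ← hb]
    exact ⟨_, hq i (Finset.mem_univ i)⟩
  have hα : α = a • l := funext hl
  have hlk : l ⬝ᵥ k = 1 := mul_left_cancel₀ ha0 <| by
    rw [mul_one, ← smul_eq_mul, ← smul_dotProduct, ← hα, ← ha]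
  -- Split `β = b • l + c • l'` along the primitive part `l` of `α`. It then suffices to obtain a
  -- common divisor of `a`, `b`, `c`.
  set b := β ⬝ᵥ k with hb
  obtain ⟨c, k', l', hc, hl'⟩ := exists_gcd_family Finset.univ (β - b • l)
  have hβ : β = b • l + c • l' := by
    ext i
    have := hl' i (Finset.mem_univ i)
    simp only [Pi.sub_apply, Pi.smul_apply, smul_eq_mul, Pi.add_apply] at this ⊢
    linear_combination this
  change c = (β - b • l) ⬝ᵥ k' at hc
  by_cases hc0 : c = 0
  · obtain ⟨d, z, q, hd, hq⟩ := exists_gcd_family Finset.univ ![a, b]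
    have hda : d ∣ a := ⟨_, hq 0 (Finset.mem_univ _)⟩
    have hdb : d ∣ b := ⟨_, hq 1 (Finset.mem_univ _)⟩
    have : (z 0 • α + z 1 • β) ⬝ᵥ k = d := by
      rw [hd, add_dotProduct, smul_dotProduct, smul_dotProduct, ← ha, ← hb]
      simp [mul_comm]
    refine ⟨z 0, z 1, k, fun i => ?_⟩
    rw [this, hβ, hα, hc0]
    simpa using ⟨hda.mul_right _, hdb.mul_right _⟩
  · obtain ⟨r, z, w, hda, hdb, hdc⟩ := hR.exists_gcd b a hc0
    -- The vector `k` extracts the coefficient `b + a r`; the correction of `k'` by a multiple of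
    -- `k` is orthogonal to `l` and extracts `c`.
    have h : (r • α + (1 : R) • β) ⬝ᵥ (z • k + w • (k' - (l ⬝ᵥ k') • k)) =
        z * (b + a * r) + w * c := by
      have hβk' : β ⬝ᵥ k' = c + b * (l ⬝ᵥ k') := by
        rw [hc, sub_dotProduct, smul_dotProduct, smul_eq_mul]; ring
      have hαk' : α ⬝ᵥ k' = a * (l ⬝ᵥ k') := by
        rw [hα, smul_dotProduct, smul_eq_mul]
      simp only [add_dotProduct, dotProduct_add, smul_dotProduct, dotProduct_smul, dotProduct_sub,
        smul_eq_mul, hβk', hαk', ← ha, ← hb]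
      ring
    refine ⟨r, 1, z • k + w • (k' - (l ⬝ᵥ k') • k), fun i => ?_⟩
    rw [h]
    constructor
    · rw [hl]
      exact hdb.mul_right _
    · rw [hβ]
      simpa using dvd_add (hda.mul_right (l i)) (hdc.mul_right (l' i))

theorem HasStableRangeOneAndHalf.exists_content (hR : HasStableRangeOneAndHalf R)
    (A : Matrix ι κ R) : ∃ x u, ∀ i j, (x ᵥ* A) ⬝ᵥ u ∣ A i j := by
  classical
  have h : ∀ F : Finset ι, ∃ (x : ι → R) (u : κ → R), ∀ i ∈ F, ∀ j, (x ᵥ* A) ⬝ᵥ u ∣ A i j := by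
    intro F
    induction F using Finset.induction_on with
    | empty => exact ⟨0, 0, by simp⟩
    | insert a F ha ih =>
      obtain ⟨x, u, hxu⟩ := ih
      obtain ⟨y, z, w, hw⟩ := hR.exists_content_pair (A a) (x ᵥ* A)
      have hrow : (y • Pi.single a 1 + z • x) ᵥ* A = y • A a + z • (x ᵥ* A) := by
        rw [add_vecMul, smul_vecMul, smul_vecMul, single_one_vecMul]
        rfl
      refine ⟨y • Pi.single a 1 + z • x, w, fun i hi j => ?_⟩
      rw [hrow]
      rcases Finset.mem_insert.1 hi with rfl | hi
      · exact (hw j).1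
      · exact (Finset.dvd_sum fun j _ => (hw j).2.mul_right _).trans (hxu i hi j)
  simpa using h Finset.univ

/-- Transvections carry `x` to the first basis row when there are at least three positions; the
inverse product then has first row `x`. Sizes 1 and 2 are completed by hand. -/
theorem HasStableRangeOneAndHalf.exists_isUnit_row_zero_eq (hR : HasStableRangeOneAndHalf R)
    {n : ℕ} {x z : Fin (n + 1) → R} (h : x ⬝ᵥ z = 1) :
    ∃ P : Matrix (Fin (n + 1)) (Fin (n + 1)) R, IsUnit P ∧ P 0 = x := by
  match n with
  | 0 =>
    refine ⟨of fun _ => x, ?_, rfl⟩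
    rw [isUnit_iff_isUnit_det, det_fin_one]
    exact IsUnit.of_mul_eq_one (z 0) (by simpa [dotProduct] using h)
  | 1 =>
    refine ⟨of ![x, ![-z 1, z 0]], ?_, rfl⟩
    rw [isUnit_iff_isUnit_det, det_fin_two]
    have : x 0 * z 0 + x 1 * z 1 = 1 := by simpa [dotProduct, Fin.sum_univ_two] using h
    simp [this]
  | n + 2 =>
    obtain ⟨e, he, hxe⟩ := hR.reaches_single (s := ∅) (p := 1) (q := ⟨2, by omega⟩) (t := 0)
      (by simp [Fin.ext_iff]) (by simp) (by simp [Fin.ext_iff]) (by simp) (by simp) (by simp) x z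
      (by simp) h
    obtain ⟨f, hf, hef⟩ := exists_inverse_mem_transvections he
    refine ⟨f, isUnit_of_mem_transvections hf, ?_⟩
    rw [← vecMul_one x, ← hef, ← vecMul_vecMul, hxe, single_one_vecMul]
    rfl

end Content

/-- The matrix with corner `a`, first row `a, r`, first column `a, c` and remaining block `D`. -/
def bordered {R : Type*} {m n : ℕ} (a : R) (r : Fin m → R) (c : Fin n → R)
    (D : Matrix (Fin n) (Fin m) R) : Matrix (Fin (n + 1)) (Fin (m + 1)) R :=
  of (vecCons (vecCons a r) fun i => vecCons (c i) (D i))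

theorem eq_bordered {R : Type*} {m n : ℕ} (A : Matrix (Fin (n + 1)) (Fin (m + 1)) R) :
    A = bordered (A 0 0) (fun j => A 0 j.succ) (fun i => A i.succ 0)
      (of fun i j => A i.succ j.succ) := by
  ext i j
  refine Fin.cases ?_ (fun i => ?_) i <;> refine Fin.cases ?_ (fun j => ?_) j <;> simp [bordered]

/-! ### Splitting off the corner and existence of Smith forms -/

section Bordered

variable {R : Type*} [CommRing R] {l m n : ℕ}

theorem bordered_mul (a a' : R) (r : Fin m → R) (r' : Fin n → R) (c : Fin l → R) (c' : Fin m → R)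
    (D : Matrix (Fin l) (Fin m) R) (D' : Matrix (Fin m) (Fin n) R) :
    bordered a r c D * bordered a' r' c' D' =
      bordered (a * a' + r ⬝ᵥ c') (a • r' + r ᵥ* D') (a' • c + D *ᵥ c')
        (vecMulVec c r' + D * D') := by
  ext i j
  refine Fin.cases ?_ (fun i => ?_) i <;> refine Fin.cases ?_ (fun j => ?_) j <;>
    simp [bordered, Matrix.mul_apply, Fin.sum_univ_succ, dotProduct, vecMul, mulVec, vecMulVec,
      mul_comm]

theorem bordered_one : bordered (1 : R) 0 0 (1 : Matrix (Fin n) (Fin n) R) = 1 := by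
  ext i j
  refine Fin.cases ?_ (fun i => ?_) i <;> refine Fin.cases ?_ (fun j => ?_) j <;>
    simp [bordered, Matrix.one_apply, Fin.succ_ne_zero, (Fin.succ_ne_zero _).symm]

theorem smul_bordered (d a : R) (r : Fin m → R) (c : Fin n → R) (D : Matrix (Fin n) (Fin m) R) :
    d • bordered a r c D = bordered (d * a) (d • r) (d • c) (d • D) := by
  ext i j
  refine Fin.cases ?_ (fun i => ?_) i <;> refine Fin.cases ?_ (fun j => ?_) j <;> simp [bordered]

theorem isUnit_bordered {P : Matrix (Fin n) (Fin n) R} (hP : IsUnit P) :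
    IsUnit (bordered 1 0 0 P) := by
  obtain ⟨Q, hQ⟩ := hP.exists_right_inv
  exact IsUnit.of_mul_eq_one (bordered 1 0 0 Q) (by simp [bordered_mul, hQ, bordered_one])

theorem exists_mul_mul_eq_bordered {A : Matrix (Fin (n + 1)) (Fin (m + 1)) R} (h : A 0 0 = 1) :
    ∃ (P : Matrix (Fin (n + 1)) (Fin (n + 1)) R) (Q : Matrix (Fin (m + 1)) (Fin (m + 1)) R)
      (B : Matrix (Fin n) (Fin m) R), IsUnit P ∧ IsUnit Q ∧ P * A * Q = bordered 1 0 0 B := by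
  rw [eq_bordered A, h]
  refine ⟨bordered 1 0 (-fun i => A i.succ 0) 1, bordered 1 (-fun j => A 0 j.succ) 0 1,
    of (fun i j => A i.succ j.succ) - vecMulVec (fun i => A i.succ 0) fun j => A 0 j.succ,
    IsUnit.of_mul_eq_one (bordered 1 0 (fun i => A i.succ 0) 1) (by
      simp [bordered_mul, bordered_one]),
    IsUnit.of_mul_eq_one (bordered 1 (fun j => A 0 j.succ) 0 1) (by
      simp [bordered_mul, bordered_one]), ?_⟩
  simp only [bordered_mul]
  congr 1 <;> simp [neg_add_eq_sub]

theorem IsSmithNormalForm.bordered [IsDomain R] {Φ : Matrix (Fin n) (Fin m) R}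
    (h : IsSmithNormalForm Φ) {d : R} (hd : d ≠ 0) :
    IsSmithNormalForm (bordered d 0 0 (d • Φ)) := by
  obtain ⟨k, hkn, hkm, φ, hφ, hdvd, rfl⟩ := h
  refine ⟨k + 1, by omega, by omega, Fin.cons d fun i => d * φ i, ?_, ?_, ?_⟩
  · exact Fin.cases hd fun i => mul_ne_zero hd (hφ i)
  · rintro (_ | i) hi
    · exact dvd_mul_right _ _
    · exact mul_dvd_mul_left d (hdvd i (by omega))
  · ext i j
    refine Fin.cases ?_ (fun i => ?_) i <;> refine Fin.cases ?_ (fun j => ?_) j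
    · simp [StableRange.bordered]
    · simp [StableRange.bordered]
    · simp [StableRange.bordered]
    · by_cases hij : (i : ℕ) = j ∧ (i : ℕ) < k
      · simp [StableRange.bordered, hij.1 ▸ hij.2, hij.1]
        rfl
      · simp [StableRange.bordered, hij]

end Bordered

theorem isSmithNormalForm_zero {R : Type*} [CommRing R] {n m : ℕ} :
    IsSmithNormalForm (0 : Matrix (Fin n) (Fin m) R) :=
  ⟨0, Nat.zero_le _, Nat.zero_le _, Fin.elim0, fun i => i.elim0, fun _ h => by omega, by
    ext i j; simp⟩

/-- A Bezout domain of stable range 1.5 is an elementary divisor ring. -/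
theorem HasStableRangeOneAndHalf.exists_isSmithNormalForm {R : Type*} [CommRing R] [IsDomain R]
    [IsBezout R] (hR : HasStableRangeOneAndHalf R) {n m : ℕ} (A : Matrix (Fin n) (Fin m) R) :
    ∃ (P : Matrix (Fin n) (Fin n) R) (Q : Matrix (Fin m) (Fin m) R),
      IsUnit P ∧ IsUnit Q ∧ IsSmithNormalForm (P * A * Q) := by
  induction n generalizing m with
  | zero =>
    refine ⟨1, 1, isUnit_one, isUnit_one, ?_⟩
    convert isSmithNormalForm_zero
    ext i
    exact i.elim0
  | succ n ih =>
    by_cases hA : A = 0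
    · exact ⟨1, 1, isUnit_one, isUnit_one, by simpa [hA] using isSmithNormalForm_zero⟩
    cases m with
    | zero => exact absurd (by ext i j; exact j.elim0) hA
    | succ m =>
      obtain ⟨x, u, hxu⟩ := hR.exists_content A
      generalize hd : (x ᵥ* A) ⬝ᵥ u = d at hxu
      choose A' hA' using hxu
      replace hA' : A = d • of A' := by ext i j; exact hA' i j
      have hd0 : d ≠ 0 := fun h => hA (by rw [hA', h, zero_smul])
      have h1 : (x ᵥ* of A') ⬝ᵥ u = 1 := mul_left_cancel₀ hd0 <| by
        rw [mul_one, ← smul_eq_mul, ← smul_dotProduct, ← vecMul_smul, ← hA', hd]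
      obtain ⟨P, hP, rfl⟩ := hR.exists_isUnit_row_zero_eq ((dotProduct_mulVec _ _ _).trans h1)
      obtain ⟨Q, hQ, rfl⟩ := hR.exists_isUnit_row_zero_eq ((dotProduct_comm _ _).trans h1)
      have h00 : (P * of A' * Qᵀ) 0 0 = 1 := by
        rw [← h1, ← Matrix.mul_apply_eq_vecMul]
        rfl
      obtain ⟨P₁, Q₁, B, hP₁, hQ₁, hB⟩ := exists_mul_mul_eq_bordered h00
      obtain ⟨P₂, Q₂, hP₂, hQ₂, hΦ⟩ := ih B
      refine ⟨bordered 1 0 0 P₂ * P₁ * P, Qᵀ * Q₁ * bordered 1 0 0 Q₂,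
        ((isUnit_bordered hP₂).mul hP₁).mul hP,
        (((Matrix.isUnit_transpose Q).2 hQ).mul hQ₁).mul (isUnit_bordered hQ₂), ?_⟩
      convert hΦ.bordered hd0 using 1
      calc bordered 1 0 0 P₂ * P₁ * P * A * (Qᵀ * Q₁ * bordered 1 0 0 Q₂)
          = d • (bordered 1 0 0 P₂ * (P₁ * (P * of A' * Qᵀ) * Q₁) * bordered 1 0 0 Q₂) := by
            rw [hA']
            simp only [Matrix.mul_assoc, Matrix.smul_mul, Matrix.mul_smul]
        _ = _ := by
            rw [hB, bordered_mul, bordered_mul, smul_bordered]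
            simp

/-! ### Elementary transforming matrices -/

section Transforming

variable {R : Type*} [CommRing R] {n m : ℕ}

theorem isProductOfElementary_of_mem_transvections {e : Matrix (Fin n) (Fin n) R}
    (he : e ∈ transvections R (∅ : Set (Fin n))) : IsProductOfElementary e := by
  obtain ⟨L, hL, rfl⟩ := Submonoid.exists_list_of_mem_closure he
  refine ⟨L, fun E hE => ?_, rfl⟩
  obtain ⟨i, j, hij, -, c, rfl⟩ := hL E hE
  exact .add i j hij c

/-- `Φ` is in Smith normal form and splits off a block `diag(a, δ a)` with `δ ≠ 0`, as it does when
it has at least two nonzero diagonal entries. -/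
def IsSmithOfRankAtLeastTwo (Φ : Matrix (Fin n) (Fin m) R) : Prop :=
  IsSmithNormalForm Φ ∧ ∃ n' m', ∃ (hn : n = 2 + n') (hm : m = 2 + m'),
    ∃ (a δ : R) (Ψ : Matrix (Fin n') (Fin m') R), δ ≠ 0 ∧
      Φ = reindex (finSumFinEquiv.trans (finCongr hn.symm))
        (finSumFinEquiv.trans (finCongr hm.symm)) (fromBlocks (diagonal ![a, δ * a]) 0 0 Ψ)

theorem IsSmithNormalForm.transpose {Φ : Matrix (Fin n) (Fin m) R}
    (h : IsSmithNormalForm Φ) : IsSmithNormalForm Φᵀ := by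
  obtain ⟨k, hkn, hkm, φ, hφ, hdvd, rfl⟩ := h
  refine ⟨k, hkm, hkn, φ, hφ, hdvd, ?_⟩
  ext i j
  simp only [transpose_apply, of_apply]
  by_cases hij : (i : ℕ) = j
  · simp [hij]
  · simp [hij, Ne.symm hij]

theorem IsSmithOfRankAtLeastTwo.transpose {Φ : Matrix (Fin n) (Fin m) R}
    (h : IsSmithOfRankAtLeastTwo Φ) : IsSmithOfRankAtLeastTwo Φᵀ := by
  obtain ⟨hΦ, n', m', hn, hm, a, δ, Ψ, hδ, hΦ'⟩ := h
  refine ⟨hΦ.transpose, m', n', hm, hn, a, δ, Ψᵀ, hδ, ?_⟩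
  rw [hΦ', transpose_reindex, fromBlocks_transpose]
  simp

theorem IsSmithNormalForm.isSmithOfRankAtLeastTwo [IsDomain R] {Φ : Matrix (Fin n) (Fin m) R}
    (h : IsSmithNormalForm Φ) (hrank : 1 < Φ.rank) : IsSmithOfRankAtLeastTwo Φ := by
  refine ⟨h, ?_⟩
  obtain ⟨k, hkn, hkm, φ, hφ, hdvd, hΦ⟩ := h
  have hk : 2 ≤ k := by
    -- With at most one nonzero diagonal entry, `Φ` is an outer product and has rank at most 1.
    by_contra! hk
    refine hrank.not_ge ?_
    have : Φ = vecMulVec (fun i : Fin n => if h : (i : ℕ) < k then φ ⟨i, h⟩ else 0)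
        fun j : Fin m => if (j : ℕ) = 0 then 1 else 0 := by
      ext i j
      rw [hΦ, vecMulVec_apply, of_apply]
      by_cases hik : (i : ℕ) < k
      · have hi : (i : ℕ) = 0 := by omega
        by_cases hj : (j : ℕ) = 0
        · simp [hi, hj]
        · simp [hi, hj, Ne.symm hj]
      · simp [hik]
    rw [this]
    exact rank_vecMulVec_le _ _
  obtain ⟨n, rfl⟩ := Nat.exists_eq_add_of_le (hk.trans hkn)
  obtain ⟨m, rfl⟩ := Nat.exists_eq_add_of_le (hk.trans hkm)
  obtain ⟨δ, hδ⟩ := hdvd 0 hk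
  refine ⟨n, m, rfl, rfl, φ ⟨0, by omega⟩, δ,
    of fun i j => Φ (Fin.natAdd 2 i) (Fin.natAdd 2 j), ?_, ?_⟩
  · rintro rfl
    exact hφ _ (hδ.trans (mul_zero _))
  · rw [← Equiv.symm_apply_eq]
    ext (i | i) (j | j)
    · fin_cases i <;> fin_cases j <;> simp [hΦ]
      · rw [dif_pos (by omega)]
      · rw [dif_pos (by omega), mul_comm]
        exact hδ
    · have : (i : ℕ) ≠ 2 + j := by omega
      simp [hΦ, this]
    · have : 2 + (i : ℕ) ≠ j := by omega
      simp [hΦ, this]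
    · simp

theorem HasStableRangeOneAndHalf.exists_mem_leftTransforming [IsDomain R] [IsBezout R]
    (hR : HasStableRangeOneAndHalf R) {A : Matrix (Fin n) (Fin m) R}
    {P : Matrix (Fin n) (Fin n) R} {Q : Matrix (Fin m) (Fin m) R} (hP : IsUnit P) (hQ : IsUnit Q)
    (h : IsSmithOfRankAtLeastTwo (P * A * Q)) :
    ∃ P ∈ leftTransforming A, IsProductOfElementary P := by
  obtain ⟨hΦ, n', m', hn, hm, a, δ, Ψ, hδ, hPAQ⟩ := h
  set σ := finSumFinEquiv.trans (finCongr hn.symm)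
  set τ := finSumFinEquiv.trans (finCongr hm.symm)
  have hg : IsUnit (reindex σ.symm σ.symm P) := hP.map (reindexAlgEquiv R R σ.symm)
  obtain ⟨e, he, H, hH, ⟨c, hc⟩, heH⟩ := hR.exists_mul_eq_fromBlocks hg hδ
  obtain ⟨f, hf, hef⟩ := exists_inverse_mem_transvections he
  -- Formally the conjugate `D⁻¹ H D` with `D = diag(1, δ)`; it has entries in `R` because `H 1 0 =
  -- δ c`, and its determinant is that of `H`.
  let K : Matrix (Fin 2) (Fin 2) R := !![H 0 0, H 0 1 * δ; c, H 1 1]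
  have hK : IsUnit K := by
    rw [isUnit_iff_isUnit_det, det_fin_two] at hH ⊢
    convert hH using 1
    simp [K, hc]
    ring
  have hHK : H * diagonal ![a, δ * a] = diagonal ![a, δ * a] * K := by
    ext i j
    fin_cases i <;> fin_cases j <;> simp [K, hc] <;> ring
  have hK' : IsUnit (fromBlocks K 0 0 (1 : Matrix (Fin m') (Fin m') R)) := by
    rw [isUnit_iff_isUnit_det] at hK ⊢
    simpa using hK
  have hf' := reindex_mem_transvections σ hf
  refine ⟨reindex σ σ f, ⟨isUnit_of_mem_transvections hf', Q * reindex τ τ (fromBlocks K 0 0 1),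
    hQ.mul (hK'.map (reindexAlgEquiv R R τ)), ?_⟩, isProductOfElementary_of_mem_transvections hf'⟩
  convert hΦ using 1
  have hH' : IsUnit (reindex σ σ (fromBlocks H 0 0 (1 : Matrix (Fin n') (Fin n') R))) := by
    refine IsUnit.map (reindexAlgEquiv R R σ) ?_
    rw [isUnit_iff_isUnit_det] at hH ⊢
    simpa using hH
  have hPf : reindex σ σ (fromBlocks H 0 0 1) * reindex σ σ f = P := by
    have : fromBlocks H 0 0 1 * f = reindex σ.symm σ.symm P := by
      rw [← heH, Matrix.mul_assoc, hef, Matrix.mul_one]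
    simpa using congr_arg (reindex σ σ) this
  obtain ⟨X, hX⟩ := hH'.exists_left_inv
  have hΦK : P * A * Q * reindex τ τ (fromBlocks K 0 0 1) =
      reindex σ σ (fromBlocks H 0 0 1) * (P * A * Q) := by
    rw [hPAQ]
    simp only [reindex_apply, submatrix_mul_equiv, fromBlocks_multiply]
    simp [hHK]
  calc reindex σ σ f * A * (Q * reindex τ τ (fromBlocks K 0 0 1))
      = X * (reindex σ σ (fromBlocks H 0 0 1) * reindex σ σ f * A * Q *
          reindex τ τ (fromBlocks K 0 0 1)) := by
        simp only [← Matrix.mul_assoc, hX, Matrix.one_mul]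
    _ = P * A * Q := by rw [hPf, hΦK, ← Matrix.mul_assoc, hX, Matrix.one_mul]

theorem IsProductOfElementary.transpose {M : Matrix (Fin n) (Fin n) R}
    (h : IsProductOfElementary M) : IsProductOfElementary Mᵀ := by
  obtain ⟨L, hL, rfl⟩ := h
  refine ⟨(L.map Matrix.transpose).reverse, fun E hE => ?_, (transpose_list_prod L).symm⟩
  rw [List.mem_reverse, List.mem_map] at hE
  obtain ⟨F, hF, rfl⟩ := hE
  rcases hL F hF with ⟨i, j, hij, c⟩ | ⟨i, j⟩ | ⟨i, u⟩
  · rw [transvection, transpose_add, transpose_one, transpose_single]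
    exact .add j i hij.symm c
  · rw [transpose_permMatrix, Equiv.swap_inv]
    exact .interchange i j
  · rw [diagonal_transpose]
    exact .scale i u

theorem HasStableRangeOneAndHalf.exists_mem_rightTransforming [IsDomain R] [IsBezout R]
    (hR : HasStableRangeOneAndHalf R) {A : Matrix (Fin n) (Fin m) R}
    {P : Matrix (Fin n) (Fin n) R} {Q : Matrix (Fin m) (Fin m) R} (hP : IsUnit P) (hQ : IsUnit Q)
    (h : IsSmithOfRankAtLeastTwo (P * A * Q)) :
    ∃ Q ∈ rightTransforming A, IsProductOfElementary Q := by
  have ht := h.transpose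
  rw [transpose_mul, transpose_mul, ← Matrix.mul_assoc] at ht
  obtain ⟨S, ⟨hS, T, hT, hST⟩, hSE⟩ := hR.exists_mem_leftTransforming
    ((isUnit_transpose Q).2 hQ) ((isUnit_transpose P).2 hP) ht
  refine ⟨Sᵀ, ⟨(isUnit_transpose S).2 hS, Tᵀ, (isUnit_transpose T).2 hT, ?_⟩, hSE.transpose⟩
  simpa [Matrix.mul_assoc] using hST.transpose

end Transforming

end StableRange

theorem theorem2 {R : Type*} [CommRing R] [IsDomain R] [IsBezout R]
    (hR : StableRange.HasStableRangeOneAndHalf R) {n m : ℕ}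
    (A : Matrix (Fin n) (Fin m) R) (hA : 1 < A.rank) :
    (∃ P ∈ StableRange.leftTransforming A, StableRange.IsProductOfElementary P) ∧
      (∃ Q ∈ StableRange.rightTransforming A, StableRange.IsProductOfElementary Q) := by
  obtain ⟨P, Q, hP, hQ, hΦ⟩ := hR.exists_isSmithNormalForm A
  have hΦ' := hΦ.isSmithOfRankAtLeastTwo <| by
    rwa [Matrix.rank_mul_eq_left_of_isUnit_det _ _ ((Matrix.isUnit_iff_isUnit_det _).1 hQ),
      Matrix.rank_mul_eq_right_of_isUnit_det _ _ ((Matrix.isUnit_iff_isUnit_det _).1 hP)]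
  exact ⟨hR.exists_mem_leftTransforming hP hQ hΦ', hR.exists_mem_rightTransforming hP hQ hΦ'⟩
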